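/- Let $\ell_2$ be the Hilbert space of square-summable complex sequences indexed by $j=1,2,\dots$, with scalar product $\langle\cdot,\cdot\rangle$. For $k\in\mathbb Z$ let $s_k$ be the Hilbert space of complex sequences $\xi$ with $|\xi|_k^2:=\sum_{j\ge1}|\xi_j|^2j^{2k}<\infty$, and let $s=\bigcap_{q\in\mathbb N_0}s_q$ be the space of rapidly decreasing sequences. Let $\mathscr L^*(s)$ be the algebra of all linear maps $x\colon s\to s$ such that every $\eta\in s$ lies in the domain of the adjoint $x^*$ of $x$ (as an unbounded operator on $\ell_2$ with domain $s$) and $x^*\eta\in s$; that is, for every $\eta\in s$ there is a (unique) $x^*\eta\in s$ with $\langle x\xi,\eta\rangle=\langle\xi,x^*\eta\rangle$ for all $\xi\in s$. Endow $\mathscr L^*(s)$ with the locally convex topology $\tau^*$ given by the seminorms $$p^{a,B}(x)=\max\Big\{\sup_{\xi\in B}\|ax\xi\|_{\ell_2},\ \sup_{\xi\in B}\|ax^*\xi\|_{\ell_2}\Big\},$$ where $a\in\mathscr L^*(s)$ and $B$ runs over the subsets of $s$ that are bounded in the graph topology, i.e. the topology on $s$ given by the seminorms $\xi\mapsto\|b\xi\|_{\ell_2}$,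 $b\in\mathscr L^*(s)$. For $m\in\mathbb N_0$ we say that $x\in\mathscr L^*(s)$ belongs to $\mathscr L(s_m,\ell_2)\cap\mathscr L(\ell_2,s_{-m})$ if $x$ extends to a continuous linear operator $s_m\to\ell_2$ which in turn extends to a continuous linear operator $\ell_2\to s_{-m}$. A continuous norm $\|\cdot\|$ on a Fréchet space $E$ is called a dominating norm if, for a fundamental system $(\|\cdot\|_q)_{q\in\mathbb N_0}$ of seminorms of $E$ (equivalently, for every such system), for all $q$ there are $r$ and $C>0$ with $\|x\|_q^2\le C\,\|x\|\,\|x\|_r$ for all $x\in E$. Let $F$ be a Fréchet subspace of $\mathscr L^*(s)$, i.e. a linear subspace which is a Fréchet space (a complete metrizable locally convex space) in the topology induced by $\tau^*$. Then there is $m\in\mathbb N_0$ such that $F\subset\mathscr L(s_m,\ell_2)\cap\mathscr L(\ell_2,s_{-m})$. Moreover, for each such $m$, the formula $$r_m(x)=\max\Big\{\sup_{\xi\in s,\,|\xi|_m\le1}\|x\xi\|_{\ell_2},\ \sup_{\xi\in s,\,|\xi|_m\le1}\|x^*\xi\|_{\ell_2}\Big\}$$ defines a (finite) dominating norm on $F$.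 -/

import Mathlib

open scoped ENNReal

noncomputable section

namespace RapidOp

/-- The Hilbert space `ℓ₂` of square-summable complex sequences indexed by `1, 2, 3, …`. -/
abbrev Ell2 : Type := lp (fun _ : ℕ+ => ℂ) 2

theorem memℓp_two_iff (f : ℕ+ → ℂ) : Memℓp f 2 ↔ Summable fun j => ‖f j‖ ^ 2 := by
  rw [memℓp_gen_iff (by norm_num)]
  simp

theorem norm_weight (k : ℤ) (ξ : ℕ+ → ℂ) (j : ℕ+) :
    ‖((j : ℕ) : ℂ) ^ k * ξ j‖ ^ 2 = ‖ξ j‖ ^ 2 * ((j : ℕ) : ℝ) ^ (2 * k) := by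
  rw [norm_mul, norm_zpow, Complex.norm_natCast, mul_pow, mul_comm, two_mul, zpow_add₀, sq (_ ^ k)]
  exact_mod_cast j.pos.ne'

theorem memℓp_weight_iff (k : ℤ) (ξ : ℕ+ → ℂ) :
    Memℓp (fun j : ℕ+ => ((j : ℕ) : ℂ) ^ k * ξ j) 2 ↔
      Summable fun j : ℕ+ => ‖ξ j‖ ^ 2 * ((j : ℕ) : ℝ) ^ (2 * k) := by
  rw [memℓp_two_iff]
  simp only [norm_weight]

/-- The sequences `ξ` with `|ξ|_k² = ∑ |ξ_j|² j^{2k} < ∞`, for `k ∈ ℤ`. -/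
def weighted (k : ℤ) : Submodule ℂ (ℕ+ → ℂ) where
  carrier := {ξ | Summable fun j : ℕ+ => ‖ξ j‖ ^ 2 * ((j : ℕ) : ℝ) ^ (2 * k)}
  zero_mem' := by simp [summable_zero]
  add_mem' {ξ η} hξ hη := by
    simp only [Set.mem_ofPred_eq, ← memℓp_weight_iff] at *
    convert hξ.add hη using 1
    ext j
    simp [mul_add]
  smul_mem' c ξ hξ := by
    simp only [Set.mem_ofPred_eq, ← memℓp_weight_iff] at *
    convert hξ.const_smul c using 1
    ext j
    simp [mul_left_comm]

/-- The Hilbert space `s_k`, `k ∈ ℤ`. It is a type of its own so that it carries the topology of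
its norm `|·|_k`, not that of pointwise convergence. -/
def SobSeq (k : ℤ) : Type := weighted k

namespace SobSeq

variable {k : ℤ}

instance : AddCommGroup (SobSeq k) := inferInstanceAs (AddCommGroup (weighted k))
instance : Module ℂ (SobSeq k) := inferInstanceAs (Module ℂ (weighted k))

/-- The underlying sequence. -/
def coord (ξ : SobSeq k) : ℕ+ → ℂ := ξ.1

/-- The map `(ξ_j) ↦ (j^k ξ_j)` from `s_k` to `ℓ₂`. -/
def scale (k : ℤ) : SobSeq k →ₗ[ℂ] Ell2 where
  toFun ξ := ⟨fun j => ((j : ℕ) : ℂ) ^ k * ξ.coord j, (memℓp_weight_iff k _).2 ξ.2⟩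
  map_add' ξ η := by
    ext j
    exact mul_add _ _ _
  map_smul' c ξ := by
    ext j
    exact mul_left_comm _ _ _

theorem scale_injective (k : ℤ) : Function.Injective (scale k) := by
  intro ξ η h
  apply Subtype.ext
  funext j
  have hj : ((j : ℕ) : ℂ) ^ k * ξ.coord j = ((j : ℕ) : ℂ) ^ k * η.coord j :=
    congrFun (congrArg Subtype.val h) j
  refine mul_left_cancel₀ (zpow_ne_zero k ?_) hj
  exact_mod_cast j.pos.ne'

/-- The norm `|ξ|_k = ‖(j^k ξ_j)_j‖_{ℓ₂}`; see `norm_sq`. -/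
instance : NormedAddCommGroup (SobSeq k) :=
  NormedAddCommGroup.induced (SobSeq k) Ell2 (scale k) (scale_injective k)

instance : NormedSpace ℂ (SobSeq k) := NormedSpace.induced ℂ (SobSeq k) Ell2 (scale k)

theorem norm_sq (ξ : SobSeq k) :
    ‖ξ‖ ^ 2 = ∑' j : ℕ+, ‖ξ.coord j‖ ^ 2 * ((j : ℕ) : ℝ) ^ (2 * k) := by
  have h : ‖ξ‖ = ‖scale k ξ‖ := rfl
  have h2 := lp.norm_rpow_eq_tsum (p := 2) (by norm_num) (scale k ξ)
  simp only [ENNReal.toReal_ofNat, Real.rpow_ofNat] at h2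
  rw [h, h2]
  exact tsum_congr fun j => norm_weight k ξ.coord j

theorem memℓp_coord {m : ℕ} (ξ : SobSeq m) : Memℓp ξ.coord 2 := by
  rw [memℓp_two_iff]
  refine Summable.of_nonneg_of_le (fun _ => by positivity) (fun j => ?_) ξ.2
  have hj : (1 : ℝ) ≤ ((j : ℕ) : ℝ) := by exact_mod_cast j.pos
  exact le_mul_of_one_le_right (by positivity) (one_le_zpow₀ hj (by positivity))

/-- The inclusion `s_m ⊂ ℓ₂` for `m ∈ ℕ₀`. -/
def toEll2 (m : ℕ) : SobSeq m →ₗ[ℂ] Ell2 where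
  toFun ξ := ⟨ξ.coord, ξ.memℓp_coord⟩
  map_add' _ _ := rfl
  map_smul' _ _ := rfl

end SobSeq

/-- The space `s` of rapidly decreasing sequences, as a vector space. -/
def S : Type := ↥(⨅ q : ℕ, weighted q)

namespace S

instance : AddCommGroup S := inferInstanceAs (AddCommGroup ↥(⨅ q : ℕ, weighted q))
instance : Module ℂ S := inferInstanceAs (Module ℂ ↥(⨅ q : ℕ, weighted q))

/-- The underlying sequence. -/
def coord (ξ : S) : ℕ+ → ℂ := ξ.1

/-- The inclusion `s ⊂ s_m`; thus `|ξ|_m = ‖ξ.toSob m‖`. -/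
def toSob (m : ℕ) : S →ₗ[ℂ] SobSeq m where
  toFun ξ := ⟨ξ.coord, (Submodule.mem_iInf _).1 ξ.2 m⟩
  map_add' _ _ := rfl
  map_smul' _ _ := rfl

/-- The inclusion `s ⊂ ℓ₂`. -/
def toEll2 : S →ₗ[ℂ] Ell2 := (SobSeq.toEll2 0).comp (toSob 0)

theorem toEll2_injective : Function.Injective toEll2 := fun _ _ h =>
  Subtype.ext (congrArg (fun f : Ell2 => (f : ℕ+ → ℂ)) h)

end S

/-- `⟨xξ, η⟩ = ⟨ξ, ζ⟩` for all `ξ ∈ s`, where `η, ζ ∈ ℓ₂`. That is, `η` lies in the domain of the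
adjoint of the unbounded operator `x` on `ℓ₂` with domain `s`, and `x* η = ζ`. -/
def IsAdjointAt (x : Module.End ℂ S) (η ζ : Ell2) : Prop :=
  ∀ ξ : S, inner ℂ (x ξ).toEll2 η = inner ℂ ξ.toEll2 ζ

/-- `𝓛*(s)`: the linear maps `x : s → s` such that every `η ∈ s` lies in the domain of `x*` and
`x* η ∈ s`. -/
def LStar : Subalgebra ℂ (Module.End ℂ S) where
  carrier := {x | ∀ η : S, ∃ ζ : S, IsAdjointAt x η.toEll2 ζ.toEll2}
  mul_mem' {x y} hx hy η := by
    obtain ⟨ζ, hζ⟩ := hx η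
    obtain ⟨θ, hθ⟩ := hy ζ
    exact ⟨θ, fun ξ => (hζ (y ξ)).trans (hθ ξ)⟩
  add_mem' {x y} hx hy η := by
    obtain ⟨ζ, hζ⟩ := hx η
    obtain ⟨θ, hθ⟩ := hy η
    refine ⟨ζ + θ, fun ξ => ?_⟩
    rw [LinearMap.add_apply, map_add, map_add, inner_add_left, inner_add_right, hζ ξ, hθ ξ]
  algebraMap_mem' c η := by
    refine ⟨starRingEnd ℂ c • η, fun ξ => ?_⟩
    rw [Module.algebraMap_end_apply, map_smul, map_smul, inner_smul_left, inner_smul_right]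

namespace LStar

theorem exists_adj (x : LStar) : ∃ f : S → S, ∀ η, IsAdjointAt x.1 η.toEll2 (f η).toEll2 :=
  ⟨fun η => (x.2 η).choose, fun η => (x.2 η).choose_spec⟩

/-- The function `η ↦ x* η` on `s`. -/
def adjFun (x : LStar) : S → S := (exists_adj x).choose

theorem adjFun_spec (x : LStar) (η : S) : IsAdjointAt x.1 η.toEll2 (adjFun x η).toEll2 :=
  (exists_adj x).choose_spec η

theorem eq_adjFun {x : LStar} {η ζ : S} (h : IsAdjointAt x.1 η.toEll2 ζ.toEll2) :
    adjFun x η = ζ := by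
  apply S.toEll2_injective
  have h0 : inner ℂ (adjFun x η - ζ).toEll2 (adjFun x η - ζ).toEll2 = (0 : ℂ) := by
    nth_rewrite 2 [map_sub]
    rw [inner_sub_right, ← h, ← adjFun_spec x η, sub_self]
  rw [inner_self_eq_zero, map_sub] at h0
  exact sub_eq_zero.1 h0

/-- The involution `x ↦ x*` (the adjoint restricted to `s`) of `𝓛*(s)`. -/
def adj (x : LStar) : LStar where
  val :=
    { toFun := adjFun x
      map_add' := fun η θ => eq_adjFun fun ξ => by
        rw [map_add, map_add, inner_add_right, inner_add_right, adjFun_spec x η ξ,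
          adjFun_spec x θ ξ]
      map_smul' := fun c η => eq_adjFun fun ξ => by
        rw [RingHom.id_apply, map_smul, map_smul, inner_smul_right, inner_smul_right,
          adjFun_spec x η ξ] }
  property η := ⟨x.1 η, fun ξ => by
    rw [← inner_conj_symm, ← inner_conj_symm (S.toEll2 ξ)]
    exact congrArg _ (adjFun_spec x ξ η).symm⟩

theorem adj_add (x y : LStar) (η : S) : (adj (x + y)).1 η = (adj x).1 η + (adj y).1 η :=
  eq_adjFun fun ξ => by
    rw [map_add, inner_add_right]
    erw [← adjFun_spec x η ξ, ← adjFun_spec y η ξ]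
    rw [← inner_add_left, ← map_add]
    rfl

theorem adj_smul (c : ℂ) (x : LStar) (η : S) :
    (adj (c • x)).1 η = starRingEnd ℂ c • (adj x).1 η :=
  eq_adjFun fun ξ => by
    rw [map_smul, inner_smul_right]
    erw [← adjFun_spec x η ξ]
    rw [← inner_smul_left, ← map_smul]
    rfl

/-- The seminorms `ξ ↦ ‖aξ‖_{ℓ₂}`, `a ∈ 𝓛*(s)`, on `s`. -/
def graphSeminorms : SeminormFamily ℂ S LStar :=
  fun a => (normSeminorm ℂ Ell2).comp (S.toEll2.comp a.1)

/-- The graph topology of `𝓛*(s)` on `s`. -/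
abbrev graphTopology : TopologicalSpace S := graphSeminorms.moduleFilterBasis.topology

/-- The subsets of `s` that are bounded in the graph topology. -/
def GraphBounded (B : Set S) : Prop :=
  @Bornology.IsVonNBounded ℂ S _ _ _ graphTopology B

theorem GraphBounded.bddAbove {B : Set S} (hB : GraphBounded B) (a : LStar) :
    BddAbove (Set.range fun ξ : B => ‖(a.1 ξ.1).toEll2‖) := by
  let _ : TopologicalSpace S := graphTopology
  have hw : WithSeminorms graphSeminorms := ⟨rfl⟩
  obtain ⟨r, -, hr⟩ := hw.isVonNBounded_iff_seminorm_bounded.1 hB a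
  refine ⟨r, ?_⟩
  rintro _ ⟨ξ, rfl⟩
  exact (hr ξ.1 ξ.2).le

/-- The pointwise supremum of a pointwise bounded family of seminorms. -/
def supSeminorm {E ι : Type*} [AddCommGroup E] [Module ℂ E] (p : ι → Seminorm ℂ E)
    (h : ∀ x, BddAbove (Set.range fun i => p i x)) : Seminorm ℂ E :=
  Seminorm.of (fun x => ⨆ i, p i x)
    (fun x y => by
      rcases isEmpty_or_nonempty ι with hι | hι
      · simp
      · exact ciSup_le fun i =>
          (map_add_le_add (p i) x y).trans (add_le_add (le_ciSup (h x) i) (le_ciSup (h y) i)))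
    (fun c x => by
      simp only [map_smul_eq_mul]
      exact (Real.mul_iSup_of_nonneg (norm_nonneg c) _).symm)

/-- `x ↦ ‖a x ξ‖_{ℓ₂}`. -/
def evalSeminorm (a : LStar) (ξ : S) : Seminorm ℂ LStar :=
  Seminorm.of (fun x => ‖(a.1 (x.1 ξ)).toEll2‖)
    (fun x y => by
      have h : (x + y).1 ξ = x.1 ξ + y.1 ξ := rfl
      rw [h, map_add, map_add]
      exact norm_add_le _ _)
    (fun c x => by
      have h : (c • x).1 ξ = c • x.1 ξ := rfl
      rw [h, map_smul, map_smul, norm_smul])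

/-- `x ↦ ‖a x* ξ‖_{ℓ₂}`. -/
def evalAdjSeminorm (a : LStar) (ξ : S) : Seminorm ℂ LStar :=
  Seminorm.of (fun x => ‖(a.1 ((adj x).1 ξ)).toEll2‖)
    (fun x y => by
      rw [adj_add, map_add, map_add]
      exact norm_add_le _ _)
    (fun c x => by
      rw [adj_smul, map_smul, map_smul, norm_smul, RCLike.norm_conj])

/-- The seminorms
`p^{a,B}(x) = max {sup_{ξ ∈ B} ‖a x ξ‖, sup_{ξ ∈ B} ‖a x* ξ‖}` on `𝓛*(s)`,
with `a ∈ 𝓛*(s)` and `B ⊂ s` bounded in the graph topology. -/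
def tauStarSeminorms : SeminormFamily ℂ LStar (LStar × {B : Set S // GraphBounded B}) :=
  fun i =>
    supSeminorm (fun ξ : i.2.1 => evalSeminorm i.1 ξ)
        (fun x => i.2.2.bddAbove (i.1 * x)) ⊔
      supSeminorm (fun ξ : i.2.1 => evalAdjSeminorm i.1 ξ)
        (fun x => i.2.2.bddAbove (i.1 * (adj x)))

instance : Nonempty (LStar × {B : Set S // GraphBounded B}) :=
  ⟨0, ∅, @Bornology.isVonNBounded_empty ℂ S _ _ _ graphTopology⟩

/-- The topology `τ*` on `𝓛*(s)`. -/
instance : TopologicalSpace LStar := tauStarSeminorms.moduleFilterBasis.topology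

theorem withSeminorms_tauStar : WithSeminorms tauStarSeminorms := ⟨rfl⟩

instance : IsTopologicalAddGroup LStar := withSeminorms_tauStar.topologicalAddGroup

/-- `x ∈ 𝓛(s_m, ℓ₂) ∩ 𝓛(ℓ₂, s_{-m})`: the map `x : s → s` extends to a continuous linear operator
`u : s_m → ℓ₂`, and `u` extends to a continuous linear operator `v : ℓ₂ → s_{-m}`. -/
def ExtendsTo (m : ℕ) (x : LStar) : Prop :=
  ∃ (u : SobSeq m →L[ℂ] Ell2) (v : Ell2 →L[ℂ] SobSeq (-m)),
    (∀ ξ : S, u (ξ.toSob m) = (x.1 ξ).toEll2) ∧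
    ∀ ξ : SobSeq m, (v (SobSeq.toEll2 m ξ)).coord = u ξ

/-- `r_m(x) = max {sup_{|ξ|_m ≤ 1} ‖xξ‖_{ℓ₂}, sup_{|ξ|_m ≤ 1} ‖x*ξ‖_{ℓ₂}}`, with values in
`[0, ∞]` and `ξ` ranging over `s`. -/
def rNorm (m : ℕ) (x : LStar) : ℝ≥0∞ :=
  max (⨆ (ξ : S) (_ : ‖ξ.toSob m‖ ≤ 1), ‖(x.1 ξ).toEll2‖ₑ)
    (⨆ (ξ : S) (_ : ‖ξ.toSob m‖ ≤ 1), ‖((adj x).1 ξ).toEll2‖ₑ)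

end LStar

section Frechet

variable (E : Type*) [AddCommGroup E] [Module ℂ E] [TopologicalSpace E]

/-- A complex Fréchet space: a complete metrizable locally convex space. -/
structure IsFrechetSpace [IsTopologicalAddGroup E] : Prop where
  continuousSMul : ContinuousSMul ℂ E
  locallyConvex : LocallyConvexSpace ℝ E
  metrizable : TopologicalSpace.MetrizableSpace E
  complete : @CompleteSpace E (IsTopologicalAddGroup.rightUniformSpace E)

variable {E}

/-- `(‖·‖_q)_q` is a fundamental system of seminorms of `E`: each `‖·‖_q` is continuous, and the
sets `{x | ‖x‖_q < ε}`, for `q ∈ ℕ₀` and `ε > 0`, form a basis of the neighbourhoods of `0`. -/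
def IsFundamentalSystem (p : ℕ → Seminorm ℂ E) : Prop :=
  (∀ q, Continuous (p q)) ∧
    ∀ U ∈ nhds (0 : E), ∃ q : ℕ, ∃ ε : ℝ, 0 < ε ∧ {x | p q x < ε} ⊆ U

/-- `ν` is a dominating norm on the Fréchet space `E`: a continuous norm such that, with respect to
a fundamental system `(‖·‖_q)_q` of seminorms, for all `q` there are `r` and `C > 0` with
`‖x‖_q² ≤ C ν(x) ‖x‖_r` for all `x`. (The condition does not depend on the system; it is
required of every system, and a system has to exist, as it does in a Fréchet space.) -/
def IsDominatingNorm (ν : Seminorm ℂ E) : Prop :=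
  Continuous ν ∧ (∀ x, ν x = 0 → x = 0) ∧ (∃ p : ℕ → Seminorm ℂ E, IsFundamentalSystem p) ∧
    ∀ p : ℕ → Seminorm ℂ E, IsFundamentalSystem p →
      ∀ q : ℕ, ∃ r : ℕ, ∃ C : ℝ, 0 < C ∧ ∀ x, p q x ^ 2 ≤ C * ν x * p r x

end Frechet

end RapidOp

end

/-! Each `x` in `𝓛*(s)` is automatically continuous from `s` to `ℓ₂`: the existence of `x*` makes `ξ
↦ ‖xξ‖` a lower semicontinuous seminorm on the Fréchet space `s`, which is barrelled
(`exists_norm_apply_le`). So `x` and `x*` are both bounded by `n |·|_m` for some `m`, `n`, and by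
duality such bounds with a given `m` amount to the two extensions (`BoundedBy.extendsTo`,
`ExtendsTo.exists_boundedBy`).

The operators obeying the bound for a fixed pair `(m, n)` form a closed set, and countably many of
these cover `F`. By Baire one of them has interior points, and linearity carries its `m` to all of
`F`.

On `F` the function `r_m` is a finite supremum of continuous seminorms, hence continuous because `F`
is barrelled. Domination rests on `‖aθ‖² = ⟨θ, a*aθ⟩ ≤ ‖θ‖ ‖a*aθ‖` for `θ = xξ` and `θ = x*ξ`: with
`‖θ‖ ≤ r_m(x) |ξ|_m` it gives `p^{a,B}(x)² ≤ D r_m(x) p^{a*a,B}(x)` (`tauStarSeminorms_sq_le`). -/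

noncomputable section

namespace RapidOp

/-! ### Diagonal weights on `s` and the duality between `s_{-k}` and `s_k` -/

namespace S

theorem mem_weighted (ξ : S) (k : ℤ) : ξ.coord ∈ weighted k := by
  have h : ξ.coord ∈ weighted (k.toNat : ℤ) := (Submodule.mem_iInf _).1 ξ.2 k.toNat
  refine Summable.of_nonneg_of_le (fun _ => by positivity) (fun j => ?_) h
  have hj : (1 : ℝ) ≤ ((j : ℕ) : ℝ) := by exact_mod_cast j.pos
  have hk := Int.self_le_toNat k
  gcongr

/-- The inclusion `s ⊂ s_k` for `k ∈ ℤ`. -/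
def toSobInt (k : ℤ) : S →ₗ[ℂ] SobSeq k where
  toFun ξ := ⟨ξ.coord, ξ.mem_weighted k⟩
  map_add' _ _ := rfl
  map_smul' _ _ := rfl

/-- The operator `(ξ_j) ↦ (j^k ξ_j)` on `s`. -/
def weightOp (k : ℤ) : Module.End ℂ S where
  toFun ξ := ⟨fun j => ((j : ℕ) : ℂ) ^ k * ξ.coord j, (Submodule.mem_iInf _).2 fun q => by
    have h : Summable _ := ξ.mem_weighted (k + q)
    refine h.congr fun j => ?_
    rw [norm_weight, mul_assoc, ← zpow_add₀ (by exact_mod_cast j.pos.ne'), ← mul_add]⟩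
  map_add' ξ η := Subtype.ext <| funext fun _ => mul_add _ _ _
  map_smul' c ξ := Subtype.ext <| funext fun _ => mul_left_comm _ _ _

theorem norm_weightOp (k : ℤ) (ξ : S) : ‖(weightOp k ξ).toEll2‖ = ‖toSobInt k ξ‖ := rfl

theorem norm_toSob (m : ℕ) (ξ : S) : ‖ξ.toSob m‖ = ‖(weightOp m ξ).toEll2‖ := rfl

theorem weightOp_neg_weightOp (k : ℤ) (ξ : S) : weightOp (-k) (weightOp k ξ) = ξ := by
  refine Subtype.ext <| funext fun j => ?_
  have hj : ((j : ℕ) : ℂ) ≠ 0 := by exact_mod_cast j.pos.ne'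
  change ((j : ℕ) : ℂ) ^ (-k) * (((j : ℕ) : ℂ) ^ k * ξ.coord j) = ξ.coord j
  rw [← mul_assoc, ← zpow_add₀ hj, neg_add_cancel, zpow_zero, one_mul]

theorem weightOp_zero (ξ : S) : weightOp 0 ξ = ξ :=
  Subtype.ext <| funext fun j => by
    change ((j : ℕ) : ℂ) ^ (0 : ℤ) * ξ.coord j = ξ.coord j
    rw [zpow_zero, one_mul]

theorem inner_weightOp (k : ℤ) (ξ η : S) :
    inner ℂ (weightOp k ξ).toEll2 η.toEll2 = inner ℂ ξ.toEll2 (weightOp k η).toEll2 := by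
  rw [lp.inner_eq_tsum, lp.inner_eq_tsum]
  refine tsum_congr fun j => ?_
  change inner ℂ (((j : ℕ) : ℂ) ^ k * ξ.coord j) (η.coord j)
    = inner ℂ (ξ.coord j) (((j : ℕ) : ℂ) ^ k * η.coord j)
  simp only [RCLike.inner_apply, map_mul, map_zpow₀, Complex.conj_natCast]
  ring

theorem norm_weightOp_mono {k l : ℤ} (h : k ≤ l) (ξ : S) :
    ‖(weightOp k ξ).toEll2‖ ≤ ‖(weightOp l ξ).toEll2‖ := by
  rw [norm_weightOp, norm_weightOp]
  refine le_of_sq_le_sq ?_ (norm_nonneg _)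
  rw [SobSeq.norm_sq, SobSeq.norm_sq]
  refine Summable.tsum_le_tsum (fun j => ?_) (ξ.mem_weighted k) (ξ.mem_weighted l)
  have hj : (1 : ℝ) ≤ ((j : ℕ) : ℝ) := by exact_mod_cast j.pos
  change ‖ξ.coord j‖ ^ 2 * _ ≤ ‖ξ.coord j‖ ^ 2 * _
  gcongr

theorem norm_toEll2_le (m : ℕ) (ξ : S) : ‖ξ.toEll2‖ ≤ ‖(weightOp m ξ).toEll2‖ := by
  simpa only [weightOp_zero] using norm_weightOp_mono (Int.natCast_nonneg m) ξ

/-- The Cauchy-Schwarz inequality for the dual pair `(s_{-k}, s_k)`. -/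
theorem norm_inner_le_weightOp (k : ℤ) (ξ η : S) :
    ‖inner ℂ ξ.toEll2 η.toEll2‖ ≤
      ‖(weightOp (-k) ξ).toEll2‖ * ‖(weightOp k η).toEll2‖ := by
  have h := inner_weightOp (-k) ξ (weightOp k η)
  rw [weightOp_neg_weightOp] at h
  rw [← h]
  exact norm_inner_le_norm _ _

/-- The sequence with the entry `c` at `i` and `0` elsewhere. -/
def unit (i : ℕ+) (c : ℂ) : S :=
  ⟨Pi.single i c, (Submodule.mem_iInf _).2 fun q => by
    refine summable_of_ne_finset_zero (s := {i}) fun j hj => ?_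
    rw [Pi.single_eq_of_ne (by simpa using hj)]
    simp⟩

/-- Finitely supported sequences are dense in `ℓ₂`, and `weightOp (-k)` supplies their preimages in
`s`. -/
theorem denseRange_toEll2_weightOp (k : ℤ) :
    DenseRange fun ξ : S => (weightOp k ξ).toEll2 := by
  intro f
  refine mem_closure_of_tendsto (lp.hasSum_single (by norm_num) f)
    (Filter.Eventually.of_forall fun t => ?_)
  change _ ∈ LinearMap.range (S.toEll2.comp (weightOp k))
  refine Submodule.sum_mem _ fun i _ => ⟨weightOp (-k) (unit i (f i)), ?_⟩
  have h := weightOp_neg_weightOp (-k) (unit i (f i))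
  rw [neg_neg] at h
  rw [LinearMap.comp_apply, h]
  rfl

end S

/-! ### Completeness of `s_k` and density of `s` in it -/

namespace SobSeq

/-- `s_k` is isometric to `ℓ₂`. -/
def scaleₗᵢ (k : ℤ) : SobSeq k ≃ₗᵢ[ℂ] Ell2 :=
  LinearIsometryEquiv.ofSurjective ⟨scale k, fun _ => rfl⟩ fun f => by
    have hj (j : ℕ+) : ((j : ℕ) : ℂ) ≠ 0 := by exact_mod_cast j.pos.ne'
    refine ⟨⟨fun j => ((j : ℕ) : ℂ) ^ (-k) * f j, (memℓp_weight_iff k _).1 ?_⟩, ?_⟩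
    · convert lp.memℓp f using 2 with j
      rw [← mul_assoc, ← zpow_add₀ (hj j), add_neg_cancel, zpow_zero, one_mul]
    · ext j
      change ((j : ℕ) : ℂ) ^ k * (((j : ℕ) : ℂ) ^ (-k) * f j) = f j
      rw [← mul_assoc, ← zpow_add₀ (hj j), add_neg_cancel, zpow_zero, one_mul]

instance (k : ℤ) : CompleteSpace (SobSeq k) :=
  ((scaleₗᵢ k).isometry.isUniformInducing.completeSpace_congr (scaleₗᵢ k).surjective).2 inferInstance

theorem denseRange_toSobInt (k : ℤ) : DenseRange (S.toSobInt k) := by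
  have h := (scaleₗᵢ k).symm.surjective.denseRange.comp (S.denseRange_toEll2_weightOp k)
    (scaleₗᵢ k).symm.continuous
  convert h using 1
  funext ξ
  exact ((scaleₗᵢ k).symm_apply_apply _).symm

theorem continuous_coord (k : ℤ) (j : ℕ+) : Continuous fun ξ : SobSeq k => ξ.coord j := by
  have h : (fun ξ : SobSeq k => ξ.coord j) =
      fun ξ => ((j : ℕ) : ℂ) ^ (-k) * (scaleₗᵢ k ξ : ℕ+ → ℂ) j := by
    funext ξ
    change _ = ((j : ℕ) : ℂ) ^ (-k) * (((j : ℕ) : ℂ) ^ k * ξ.coord j)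
    rw [← mul_assoc, ← zpow_add₀ (by exact_mod_cast j.pos.ne'), neg_add_cancel, zpow_zero, one_mul]
  rw [h]
  exact continuous_const.mul
    ((lp.evalCLM ℂ (fun _ : ℕ+ => ℂ) 2 j).continuous.comp (scaleₗᵢ k).continuous)

theorem norm_toEll2_le (m : ℕ) (ξ : SobSeq m) : ‖toEll2 m ξ‖ ≤ ‖ξ‖ := by
  refine le_of_sq_le_sq ?_ (norm_nonneg _)
  have h2 := lp.norm_rpow_eq_tsum (p := 2) (by norm_num) (toEll2 m ξ)
  simp only [ENNReal.toReal_ofNat, Real.rpow_ofNat] at h2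
  rw [norm_sq, h2]
  refine Summable.tsum_le_tsum (fun j => ?_) ((memℓp_two_iff _).1 ξ.memℓp_coord) ξ.2
  have hj : (1 : ℝ) ≤ ((j : ℕ) : ℝ) := by exact_mod_cast j.pos
  exact le_mul_of_one_le_right (by positivity) (one_le_zpow₀ hj (by positivity))

end SobSeq

/-! ### `s` as a closed subspace of a countable power of `ℓ₂` -/

namespace S

/-- The map `ξ ↦ ((j^q ξ_j)_j)_q` from `s` to the countable power of `ℓ₂`. -/
def toPi : S →ₗ[ℂ] (ℕ → Ell2) := LinearMap.pi fun q => S.toEll2.comp (weightOp q)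

theorem toPi_apply (ξ : S) (q : ℕ) : toPi ξ q = (weightOp q ξ).toEll2 := rfl

theorem toPi_injective : Function.Injective toPi := fun ξ η h => by
  have h0 := congrFun h 0
  simp only [toPi_apply, Nat.cast_zero, weightOp_zero] at h0
  exact toEll2_injective h0

/-- The range is cut out by the equations `f_q(j) = j^q f_0(j)`, which involve only continuous
coordinate functionals. -/
theorem isClosed_range_toPi : IsClosed (Set.range toPi) := by
  have hr : Set.range toPi = ⋂ (q : ℕ) (j : ℕ+),
      {f : ℕ → Ell2 | (f q : ℕ+ → ℂ) j = ((j : ℕ) : ℂ) ^ (q : ℤ) * (f 0 : ℕ+ → ℂ) j} := by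
    ext f
    simp only [Set.mem_range, Set.mem_iInter, Set.mem_ofPred_eq]
    constructor
    · rintro ⟨ξ, rfl⟩ q j
      simp only [toPi_apply, Nat.cast_zero, weightOp_zero]
      rfl
    · intro hf
      refine ⟨⟨f 0, (Submodule.mem_iInf _).2 fun q => (memℓp_weight_iff q _).1 ?_⟩, ?_⟩
      · convert lp.memℓp (f q) using 2 with j
        exact (hf q j).symm
      · funext q
        ext j
        exact (hf q j).symm
  rw [hr]
  refine isClosed_iInter fun q => isClosed_iInter fun j => ?_
  have hc (q : ℕ) : Continuous fun f : ℕ → Ell2 => (f q : ℕ+ → ℂ) j :=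
    (lp.evalCLM ℂ (fun _ : ℕ+ => ℂ) 2 j).continuous.comp (continuous_apply q)
  exact isClosed_eq (hc q) (continuous_const.mul (hc 0))

theorem norm_le_of_forall_inner {η : S} {c : ℝ}
    (h : ∀ ζ : S, ‖inner ℂ η.toEll2 ζ.toEll2‖ ≤ c * ‖ζ.toEll2‖) : ‖η.toEll2‖ ≤ c := by
  have h1 := h η
  rw [inner_self_eq_norm_sq_to_K, norm_pow, RCLike.norm_ofReal, abs_norm, sq] at h1
  rcases (norm_nonneg η.toEll2).eq_or_lt with h0 | h0
  -- The sign of `c` is not known beforehand; for `η = 0` testing against a nonzero unit vector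
  -- forces `c ≥ 0`.
  · rw [← h0]
    by_contra! hc
    let e : S := unit 1 1
    have he : 0 < ‖e.toEll2‖ := by
      rw [norm_pos_iff]
      intro he
      have := congrArg (fun f : Ell2 => (f : ℕ+ → ℂ) 1) he
      change (Pi.single (1 : ℕ+) (1 : ℂ) : ℕ+ → ℂ) 1 = 0 at this
      simp at this
    have := (norm_nonneg _).trans (h e)
    nlinarith
  · exact le_of_mul_le_mul_right h1 h0

end S

/-! ### Automatic continuity of the elements of `𝓛*(s)` -/

namespace LStar

open S

theorem inner_apply (x : LStar) (ξ η : S) :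
    inner ℂ (x.1 ξ).toEll2 η.toEll2 = inner ℂ ξ.toEll2 ((adj x).1 η).toEll2 :=
  adjFun_spec x η ξ

/-- `(ξ_j) ↦ (j^k ξ_j)` as an element of `𝓛*(s)`. -/
def weight (k : ℤ) : LStar := ⟨weightOp k, fun η => ⟨weightOp k η, fun ξ => inner_weightOp k ξ η⟩⟩

theorem norm_sq_apply_le (x : LStar) (ξ : S) :
    ‖(x.1 ξ).toEll2‖ ^ 2 ≤ ‖ξ.toEll2‖ * ‖((adj x).1 (x.1 ξ)).toEll2‖ := by
  have h := inner_apply x ξ (x.1 ξ)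
  have h1 := norm_inner_le_norm (𝕜 := ℂ) ξ.toEll2 ((adj x).1 (x.1 ξ)).toEll2
  rwa [← h, inner_self_eq_norm_sq_to_K, norm_pow, RCLike.norm_ofReal, abs_norm] at h1

/-- Elements of `𝓛*(s)` are continuous from `s` to `ℓ₂`. -/
theorem exists_norm_apply_le (x : LStar) :
    ∃ (m : ℕ) (C : ℝ), 0 ≤ C ∧ ∀ ξ : S, ‖(x.1 ξ).toEll2‖ ≤ C * ‖(weightOp m ξ).toEll2‖ := by
  -- With the topology of all the norms `|·|_q`, `s` is closed in `ℓ₂^ℕ`, so completely metrizable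
  -- and barrelled.
  let _ : TopologicalSpace S := .induced toPi inferInstance
  have hemb : Topology.IsClosedEmbedding toPi :=
    ⟨⟨⟨rfl⟩, toPi_injective⟩, isClosed_range_toPi⟩
  have := hemb.IsCompletelyMetrizableSpace
  have : IsTopologicalAddGroup S := topologicalAddGroup_induced toPi
  have : ContinuousSMul ℂ S := continuousSMul_induced toPi
  let p : Seminorm ℂ S := (normSeminorm ℂ Ell2).comp (S.toEll2.comp x.1)
  have hp : Continuous p := by
    refine p.continuous_of_lowerSemicontinuous
      (lowerSemicontinuous_iff_isClosed_preimage.2 fun c => ?_)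
    -- Moving `x` to the other side as `x*` leaves functionals `ξ ↦ ⟨ξ, x*η⟩`, which are continuous,
    -- so the sublevel sets are closed.
    have hset : p ⁻¹' Set.Iic c = ⋂ η : S,
        {ξ | ‖inner ℂ ξ.toEll2 ((adj x).1 η).toEll2‖ ≤ c * ‖η.toEll2‖} := by
      ext ξ
      simp only [Set.mem_preimage, Set.mem_Iic, Set.mem_iInter, Set.mem_ofPred_eq, ← inner_apply]
      exact ⟨fun h η => (norm_inner_le_norm _ _).trans
        (mul_le_mul_of_nonneg_right h (norm_nonneg _)), norm_le_of_forall_inner⟩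
    rw [hset]
    refine isClosed_iInter fun η => isClosed_le (Continuous.norm (Continuous.inner ?_
      continuous_const)) continuous_const
    have h := (continuous_apply 0).comp hemb.continuous
    convert h using 1
    funext ξ
    simp only [Function.comp_apply, toPi_apply, Nat.cast_zero, weightOp_zero]
  have hw := LinearMap.withSeminorms_induced
    (withSeminorms_pi fun _ : ℕ => norm_withSeminorms ℂ Ell2) toPi
  obtain ⟨t, C, -, hC⟩ := Seminorm.bound_of_continuous hw p hp
  refine ⟨t.sup Sigma.fst, C, C.2, fun ξ => (hC ξ).trans ?_⟩
  refine mul_le_mul_of_nonneg_left (Seminorm.finset_sup_apply_le (norm_nonneg _) fun i hi => ?_) C.2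
  exact norm_weightOp_mono (by exact_mod_cast Finset.le_sup (f := Sigma.fst) hi) ξ

end LStar

/-! ### Bounds by `|·|_m` and extensions to `s_m` and `ℓ₂` -/

namespace LStar

open S

/-- `‖xξ‖ ≤ C |ξ|_m` and `‖x*ξ‖ ≤ C |ξ|_m` for all `ξ ∈ s`. -/
def BoundedBy (m : ℕ) (C : ℝ) (x : LStar) : Prop :=
  ∀ ξ : S, ‖(x.1 ξ).toEll2‖ ≤ C * ‖ξ.toSob m‖ ∧ ‖((adj x).1 ξ).toEll2‖ ≤ C * ‖ξ.toSob m‖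

theorem exists_boundedBy (x : LStar) : ∃ (m : ℕ) (n : ℕ), BoundedBy m n x := by
  obtain ⟨m, C, hC, h⟩ := exists_norm_apply_le x
  obtain ⟨m', C', hC', h'⟩ := exists_norm_apply_le (adj x)
  obtain ⟨n, hn⟩ := exists_nat_ge (max C C')
  refine ⟨max m m', n, fun ξ => ⟨(h ξ).trans ?_, (h' ξ).trans ?_⟩⟩
  · exact mul_le_mul ((le_max_left _ _).trans hn)
      (norm_weightOp_mono (by exact_mod_cast le_max_left _ _) ξ) (norm_nonneg _) (by positivity)
  · exact mul_le_mul ((le_max_right _ _).trans hn)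
      (norm_weightOp_mono (by exact_mod_cast le_max_right _ _) ξ) (norm_nonneg _) (by positivity)

/-- This is the transpose of the bound on `x*`. For `θ = (j^{-m} (xξ)_j)_j` and `θ' = (j^{-m}
θ_j)_j` one has `‖θ‖² = ⟨xξ, θ'⟩ = ⟨ξ, x*θ'⟩` and `|θ'|_m = ‖θ‖`. -/
theorem BoundedBy.norm_weightOp_neg_le {m : ℕ} {C : ℝ} {x : LStar} (h : BoundedBy m C x) (ξ : S) :
    ‖(weightOp (-m) (x.1 ξ)).toEll2‖ ≤ C * ‖ξ.toEll2‖ := by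
  set θ := weightOp (-m) (x.1 ξ) with hθ
  have h1 : ‖θ.toEll2‖ ^ 2 ≤ ‖ξ.toEll2‖ * (C * ‖θ.toEll2‖) := by
    have hw : weightOp m (weightOp (-m) θ) = θ := by
      simpa only [neg_neg] using weightOp_neg_weightOp (-m) θ
    calc ‖θ.toEll2‖ ^ 2 = ‖inner ℂ θ.toEll2 θ.toEll2‖ := by
          rw [inner_self_eq_norm_sq_to_K, norm_pow, RCLike.norm_ofReal, abs_norm]
      _ = ‖inner ℂ ξ.toEll2 ((adj x).1 (weightOp (-m) θ)).toEll2‖ := by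
          rw [← inner_apply, norm_inner_symm (x.1 ξ).toEll2, ← inner_weightOp]
      _ ≤ ‖ξ.toEll2‖ * ‖((adj x).1 (weightOp (-m) θ)).toEll2‖ := norm_inner_le_norm _ _
      _ ≤ ‖ξ.toEll2‖ * (C * ‖θ.toEll2‖) := by
          gcongr
          simpa only [norm_toSob, hw] using (h (weightOp (-m) θ)).2
  rcases (norm_nonneg θ.toEll2).eq_or_lt with h0 | h0
  · rw [← h0]
    have := (norm_nonneg _).trans (h ξ).1
    rcases (norm_nonneg ξ.toEll2).eq_or_lt with h2 | h2
    · simp [← h2]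
    · have h3 := h2.trans_le (norm_toEll2_le m ξ)
      exact mul_nonneg (nonneg_of_mul_nonneg_left this h3) h2.le
  · refine le_of_mul_le_mul_right ?_ h0
    linarith

/-- An operator with `‖xξ‖, ‖x*ξ‖ ≤ C |ξ|_m` extends to `s_m → ℓ₂` and to `ℓ₂ → s_{-m}`. -/
theorem BoundedBy.extendsTo {m : ℕ} {C : ℝ} {x : LStar} (h : BoundedBy m C x) :
    ExtendsTo m x := by
  have hd : DenseRange (S.toSob m) := SobSeq.denseRange_toSobInt m
  have hd' : DenseRange S.toEll2 := by
    simpa only [weightOp_zero] using S.denseRange_toEll2_weightOp 0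
  let f : S →ₗ[ℂ] Ell2 := S.toEll2.comp x.1
  let g : S →ₗ[ℂ] SobSeq (-m) := (toSobInt (-m)).comp x.1
  have hu := LinearMap.extendOfNorm_eq (f := f) hd ⟨C, fun ξ => (h ξ).1⟩
  have hv := LinearMap.extendOfNorm_eq (f := g) hd' ⟨C, h.norm_weightOp_neg_le⟩
  refine ⟨f.extendOfNorm (S.toSob m), g.extendOfNorm S.toEll2, hu, fun ξ => funext fun j => ?_⟩
  have hi : Continuous (SobSeq.toEll2 m) :=
    AddMonoidHomClass.continuous_of_bound _ 1 fun ξ => by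
      simpa only [one_mul] using SobSeq.norm_toEll2_le m ξ
  -- Coordinatewise, both sides are continuous on `s_m` and agree on the dense subspace `s`.
  refine congrFun (hd.equalizer
    (g := fun ξ => (g.extendOfNorm S.toEll2 (SobSeq.toEll2 m ξ)).coord j)
    (h := fun ξ => (f.extendOfNorm (S.toSob m) ξ : ℕ+ → ℂ) j)
    ((SobSeq.continuous_coord _ j).comp ((g.extendOfNorm S.toEll2).continuous.comp hi))
    ((lp.evalCLM ℂ (fun _ : ℕ+ => ℂ) 2 j).continuous.comp
      (f.extendOfNorm (S.toSob m)).continuous) (funext fun η => ?_)) ξ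
  have hη : SobSeq.toEll2 m (S.toSob m η) = S.toEll2 η := rfl
  simp only [Function.comp_apply, hη, hu, hv]
  rfl

/-- The operator `u` bounds `x`, while `v` bounds `x*` by duality: for `θ = x*ξ`, `‖θ‖² = |⟨xθ, ξ⟩|
≤ |xθ|_{-m} |ξ|_m ≤ ‖v‖ ‖θ‖ |ξ|_m`. -/
theorem ExtendsTo.exists_boundedBy {m : ℕ} {x : LStar} (h : ExtendsTo m x) :
    ∃ C : ℝ, 0 ≤ C ∧ BoundedBy m C x := by
  obtain ⟨u, v, hu, hv⟩ := h
  have hv' (ξ : S) : v ξ.toEll2 = toSobInt (-m) (x.1 ξ) := by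
    apply Subtype.ext
    have := hv (ξ.toSob m)
    rw [hu] at this
    exact this
  refine ⟨max ‖u‖ ‖v‖, by positivity, fun ξ => ⟨?_, ?_⟩⟩
  · rw [← hu]
    exact (u.le_opNorm _).trans (mul_le_mul_of_nonneg_right (le_max_left _ _) (norm_nonneg _))
  · refine LE.le.trans ?_ (mul_le_mul_of_nonneg_right (le_max_right _ _) (norm_nonneg _))
    set θ := (adj x).1 ξ with hθ
    have h1 : ‖θ.toEll2‖ ^ 2 ≤ ‖v‖ * ‖θ.toEll2‖ * ‖ξ.toSob m‖ :=
      calc ‖θ.toEll2‖ ^ 2 = ‖inner ℂ (x.1 θ).toEll2 ξ.toEll2‖ := by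
            rw [inner_apply, ← hθ, inner_self_eq_norm_sq_to_K, norm_pow, RCLike.norm_ofReal,
              abs_norm]
        _ ≤ ‖(weightOp (-m) (x.1 θ)).toEll2‖ * ‖(weightOp m ξ).toEll2‖ :=
            norm_inner_le_weightOp m _ _
        _ ≤ ‖v‖ * ‖θ.toEll2‖ * ‖ξ.toSob m‖ := by
            rw [norm_toSob]
            gcongr
            rw [norm_weightOp, ← hv']
            exact v.le_opNorm _
    rcases (norm_nonneg θ.toEll2).eq_or_lt with h0 | h0
    · rw [← h0]
      positivity
    · refine le_of_mul_le_mul_right ?_ h0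
      linarith

/-! ### Seminorms of `τ*` and the interpolation inequality -/

theorem graphBounded_singleton (ξ : S) : GraphBounded {ξ} := by
  let _ : TopologicalSpace S := graphTopology
  have hw : WithSeminorms graphSeminorms := ⟨rfl⟩
  have := hw.continuousSMul
  have := hw.topologicalAddGroup
  exact Bornology.isVonNBounded_singleton ξ

theorem tauStarSeminorms_apply (a : LStar) (B : {B : Set S // GraphBounded B}) (x : LStar) :
    tauStarSeminorms (a, B) x =
      max (⨆ ξ : B.1, ‖(a.1 (x.1 ξ)).toEll2‖) (⨆ ξ : B.1, ‖(a.1 ((adj x).1 ξ)).toEll2‖) := rfl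

theorem norm_apply_le_tauStarSeminorms (a : LStar) (B : {B : Set S // GraphBounded B}) (x : LStar)
    {ξ : S} (hξ : ξ ∈ B.1) : ‖(a.1 (x.1 ξ)).toEll2‖ ≤ tauStarSeminorms (a, B) x := by
  rw [tauStarSeminorms_apply]
  exact (le_ciSup (B.2.bddAbove (a * x)) ⟨ξ, hξ⟩).trans (le_max_left _ _)

theorem norm_adj_apply_le_tauStarSeminorms (a : LStar) (B : {B : Set S // GraphBounded B})
    (x : LStar) {ξ : S} (hξ : ξ ∈ B.1) :
    ‖(a.1 ((adj x).1 ξ)).toEll2‖ ≤ tauStarSeminorms (a, B) x := by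
  rw [tauStarSeminorms_apply]
  exact (le_ciSup (B.2.bddAbove (a * adj x)) ⟨ξ, hξ⟩).trans (le_max_right _ _)

theorem tauStarSeminorms_le {a : LStar} {B : {B : Set S // GraphBounded B}} {x : LStar} {c : ℝ}
    (hc : 0 ≤ c) (h : ∀ ξ ∈ B.1, ‖(a.1 (x.1 ξ)).toEll2‖ ≤ c ∧ ‖(a.1 ((adj x).1 ξ)).toEll2‖ ≤ c) :
    tauStarSeminorms (a, B) x ≤ c := by
  rw [tauStarSeminorms_apply]
  exact max_le (Real.iSup_le (fun ξ => (h ξ.1 ξ.2).1) hc) (Real.iSup_le (fun ξ => (h ξ.1 ξ.2).2) hc)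

/-- `x ↦ max {‖xξ‖, ‖x*ξ‖}`. -/
def pointSeminorm (ξ : S) : Seminorm ℂ LStar := evalSeminorm 1 ξ ⊔ evalAdjSeminorm 1 ξ

theorem pointSeminorm_apply (ξ : S) (x : LStar) :
    pointSeminorm ξ x = max ‖(x.1 ξ).toEll2‖ ‖((adj x).1 ξ).toEll2‖ := rfl

theorem continuous_pointSeminorm (ξ : S) : Continuous (pointSeminorm ξ) := by
  refine Seminorm.continuous_of_le
    (withSeminorms_tauStar.continuous_seminorm (1, ⟨{ξ}, graphBounded_singleton ξ⟩)) fun x => ?_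
  rw [pointSeminorm_apply]
  exact max_le (norm_apply_le_tauStarSeminorms 1 _ x rfl)
    (norm_adj_apply_le_tauStarSeminorms 1 _ x rfl)

theorem boundedBy_iff {m : ℕ} {C : ℝ} {x : LStar} :
    BoundedBy m C x ↔ ∀ ξ : S, pointSeminorm ξ x ≤ C * ‖ξ.toSob m‖ :=
  forall_congr' fun _ => max_le_iff.symm

/-- The interpolation inequality between `r_m` and the seminorms of `τ*`. -/
theorem tauStarSeminorms_sq_le (a : LStar) (B : {B : Set S // GraphBounded B}) (m : ℕ) :
    ∃ D : ℝ, 0 ≤ D ∧ ∀ (x : LStar) (r : ℝ), 0 ≤ r → BoundedBy m r x →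
      tauStarSeminorms (a, B) x ^ 2 ≤ D * r * tauStarSeminorms (adj a * a, B) x := by
  -- Since `|ξ|_m` is the graph seminorm of `weight m`, it is bounded on `B`. The bound may be
  -- negative if `B` is empty, hence `max D 0`.
  obtain ⟨D, hD⟩ := B.2.bddAbove (weight m)
  have hD (ξ : S) (hξ : ξ ∈ B.1) : ‖ξ.toSob m‖ ≤ max D 0 :=
    (hD ⟨⟨ξ, hξ⟩, rfl⟩).trans (le_max_left _ _)
  refine ⟨max D 0, le_max_right _ _, fun x r hr hx => ?_⟩
  have hnn : 0 ≤ tauStarSeminorms (adj a * a, B) x := apply_nonneg _ _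
  have hD0 : 0 ≤ max D 0 := le_max_right _ _
  have key (ξ θ : S) (hξ : ξ ∈ B.1) (h1 : ‖θ.toEll2‖ ≤ r * ‖ξ.toSob m‖)
      (h2 : ‖((adj a).1 (a.1 θ)).toEll2‖ ≤ tauStarSeminorms (adj a * a, B) x) :
      ‖(a.1 θ).toEll2‖ ≤ Real.sqrt (max D 0 * r * tauStarSeminorms (adj a * a, B) x) := by
    -- Under a square root the estimate is a uniform upper bound, so it passes to the suprema over
    -- `B`.
    refine Real.le_sqrt_of_sq_le ((norm_sq_apply_le a θ).trans ?_)
    refine mul_le_mul (h1.trans ?_) h2 (norm_nonneg _) (by positivity)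
    rw [mul_comm]
    exact mul_le_mul_of_nonneg_right (hD ξ hξ) hr
  have h := tauStarSeminorms_le (a := a) (B := B) (x := x) (Real.sqrt_nonneg _) fun ξ hξ =>
    ⟨key ξ _ hξ (hx ξ).1 (norm_apply_le_tauStarSeminorms (adj a * a) B x hξ),
      key ξ _ hξ (hx ξ).2 (norm_adj_apply_le_tauStarSeminorms (adj a * a) B x hξ)⟩
  exact (Real.le_sqrt (apply_nonneg _ _) (by positivity)).1 h

end LStar

/-! ### Baire property and fundamental systems of seminorms -/

namespace IsFrechetSpace

variable {E : Type*} [AddCommGroup E] [Module ℂ E] [TopologicalSpace E] [IsTopologicalAddGroup E]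

theorem baireSpace (h : IsFrechetSpace E) : BaireSpace E := by
  let _ : UniformSpace E := IsTopologicalAddGroup.rightUniformSpace E
  have := isUniformAddGroup_of_addCommGroup (G := E)
  have := h.complete
  have := h.metrizable
  have := IsUniformAddGroup.uniformity_countably_generated (α := E)
  infer_instance

end IsFrechetSpace

section Seminorms

variable {E : Type*} [AddCommGroup E] [Module ℂ E] [TopologicalSpace E]

theorem _root_.WithSeminorms.comp_subtype {ι : Type*} {P : SeminormFamily ℂ E ι}
    (hP : WithSeminorms P) (F : Submodule ℂ E) :
    WithSeminorms (fun i => (P i).comp F.subtype : SeminormFamily ℂ F ι) :=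
  LinearMap.withSeminorms_induced hP F.subtype

theorem exists_ne_zero_add_smul_mem [ContinuousAdd E] [ContinuousSMul ℂ E] {U : Set E} {x₀ : E}
    (hU : U ∈ nhds x₀) (x : E) : ∃ t : ℂ, t ≠ 0 ∧ x₀ + t • x ∈ U := by
  have hlim : Filter.Tendsto (fun t : ℂ => x₀ + t • x) (nhdsWithin 0 {0}ᶜ) (nhds x₀) := by
    have hc : Continuous fun t : ℂ => x₀ + t • x := by fun_prop
    simpa using (hc.tendsto 0).mono_left nhdsWithin_le_nhds
  exact ((eventually_mem_nhdsWithin (a := (0 : ℂ)) (s := {0}ᶜ)).and (hlim.eventually hU)).exists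

theorem IsFundamentalSystem.exists_le {p : ℕ → Seminorm ℂ E} (hp : IsFundamentalSystem p)
    {g : Seminorm ℂ E} (hg : Continuous g) : ∃ (r : ℕ) (C : ℝ), 0 < C ∧ ∀ x, g x ≤ C * p r x := by
  obtain ⟨r, ε, hε, hr⟩ := hp.2 {x | g x < 1}
    ((isOpen_lt hg continuous_const).mem_nhds (by simp))
  refine ⟨r, ε⁻¹, inv_pos.2 hε, fun x => ?_⟩
  -- The slack `δ` keeps the scaling factor `t` finite when `p r x = 0`.
  refine le_of_forall_pos_lt_add fun δ hδ => ?_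
  have hpos : 0 < p r x + ε * δ := by
    have := apply_nonneg (p r) x
    positivity
  set t : ℝ := ε / (p r x + ε * δ) with ht
  have htpos : 0 < t := div_pos hε hpos
  have h1 : g ((t : ℂ) • x) < 1 := hr <| by
    change p r ((t : ℂ) • x) < ε
    rw [map_smul_eq_mul, Complex.norm_real, Real.norm_of_nonneg htpos.le, ht, div_mul_eq_mul_div,
      div_lt_iff₀ hpos]
    have : 0 < ε * δ := by positivity
    nlinarith
  rw [map_smul_eq_mul, Complex.norm_real, Real.norm_of_nonneg htpos.le, ht, div_mul_eq_mul_div,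
    div_lt_one hpos] at h1
  have h2 := (lt_div_iff₀' hε).2 h1
  rw [add_div, mul_div_cancel_left₀ _ hε.ne', div_eq_inv_mul] at h2
  exact h2

theorem exists_isFundamentalSystem {ι : Type*} [Nonempty ι] [FirstCountableTopology E]
    {P : SeminormFamily ℂ E ι} (hP : WithSeminorms P) :
    ∃ p : ℕ → Seminorm ℂ E, IsFundamentalSystem p := by
  obtain ⟨U, hU⟩ := (nhds (0 : E)).exists_antitone_basis
  have h (n : ℕ) : ∃ s : Finset ι, ∃ ε > 0, (s.sup P).ball 0 ε ⊆ U n :=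
    (hP.mem_nhds_iff 0 _).1 (hU.mem n)
  choose s ε hε hs using h
  have := hP.topologicalAddGroup
  have hc (n : ℕ) : Continuous ⇑((s n).sup P) :=
    Seminorm.continuous_finsetSup fun i _ => hP.continuous_seminorm i
  refine ⟨fun n => (s n).sup P, hc, fun V hV => ?_⟩
  obtain ⟨n, hn⟩ := hU.mem_iff.1 hV
  refine ⟨n, ε n, hε n, fun x hx => hn (hs n ?_)⟩
  rwa [Seminorm.mem_ball_zero]

/-- If each seminorm of a generating family satisfies an interpolation estimate with respect to
`ν`, then every continuous seminorm does. -/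
theorem exists_sq_le_of_continuous {ι : Type*} [Nonempty ι] [IsTopologicalAddGroup E]
    {P : SeminormFamily ℂ E ι} (hP : WithSeminorms P) {ν : Seminorm ℂ E}
    (h : ∀ i, ∃ g : Seminorm ℂ E, Continuous g ∧ ∀ x, P i x ^ 2 ≤ ν x * g x)
    {q : Seminorm ℂ E} (hq : Continuous q) :
    ∃ g : Seminorm ℂ E, Continuous g ∧ ∀ x, q x ^ 2 ≤ ν x * g x := by
  classical
  have hsup (s : Finset ι) :
      ∃ g : Seminorm ℂ E, Continuous g ∧ ∀ x, s.sup P x ^ 2 ≤ ν x * g x := by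
    induction s using Finset.induction_on with
    | empty => exact ⟨0, continuous_const, fun x => by simp⟩
    | insert i s _ ih =>
      obtain ⟨g, hg, hgs⟩ := ih
      obtain ⟨g', hg', hgi⟩ := h i
      -- The square of a maximum is one of the two squares, so the sum of the two bounds suffices.
      refine ⟨g' + g, hg'.add hg, fun x => ?_⟩
      have h0 := apply_nonneg ν x
      have h1 := mul_nonneg h0 (apply_nonneg g x)
      have h2 := mul_nonneg h0 (apply_nonneg g' x)
      rw [Finset.sup_insert, add_apply, mul_add, Seminorm.sup_apply]
      rcases max_choice (P i x) (s.sup P x) with hm | hm <;> rw [hm]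
      · linarith [hgi x]
      · linarith [hgs x]
  obtain ⟨s, C, -, hC⟩ := Seminorm.bound_of_continuous hP q hq
  obtain ⟨g, hg, hgs⟩ := hsup s
  refine ⟨(C ^ 2) • g, hg.const_smul _, fun x => ?_⟩
  have h1 : q x ≤ C * s.sup P x := hC x
  calc q x ^ 2 ≤ (C * s.sup P x) ^ 2 := pow_le_pow_left₀ (apply_nonneg _ _) h1 2
    _ = C ^ 2 * s.sup P x ^ 2 := mul_pow _ _ _
    _ ≤ C ^ 2 * (ν x * g x) := mul_le_mul_of_nonneg_left (hgs x) (by positivity)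
    _ = ν x * (C ^ 2 * g x) := by ring

end Seminorms

/-! ### The common `m` and the dominating norm `r_m` -/

namespace LStar

open S

theorem exists_forall_extendsTo (F : Submodule ℂ LStar) (hF : IsFrechetSpace F) :
    ∃ m : ℕ, ∀ x ∈ F, ExtendsTo m x := by
  have := hF.baireSpace
  have := hF.continuousSMul
  let A (i : ℕ × ℕ) : Set F := {x | BoundedBy i.1 i.2 x.1}
  have hA (i : ℕ × ℕ) : IsClosed (A i) := by
    simp only [A, boundedBy_iff, Set.ofPred_forall]
    exact isClosed_iInter fun ξ => isClosed_le
      ((continuous_pointSeminorm ξ).comp continuous_subtype_val) continuous_const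
  have hU : ⋃ i, A i = Set.univ := Set.eq_univ_of_forall fun x => by
    obtain ⟨m, n, h⟩ := exists_boundedBy x.1
    exact Set.mem_iUnion.2 ⟨(m, n), h⟩
  obtain ⟨⟨m, n⟩, x₀, hx₀⟩ := nonempty_interior_of_iUnion_of_closed hA hU
  refine ⟨m, fun x hx => ?_⟩
  obtain ⟨t, ht0, ht⟩ :=
    exists_ne_zero_add_smul_mem (mem_interior_iff_mem_nhds.1 hx₀) (⟨x, hx⟩ : F)
  have ht0 : 0 < ‖t‖ := norm_pos_iff.2 ht0
  have h1 := boundedBy_iff.1 ht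
  have h2 := boundedBy_iff.1 (interior_subset hx₀)
  -- Write `x = t⁻¹ ((x₀ + t x) - x₀)`; both terms in the difference are bounded by `n |·|_m`.
  refine BoundedBy.extendsTo (C := ‖t‖⁻¹ * (n + n)) (boundedBy_iff.2 fun ξ => ?_)
  have h3 : ‖t‖ * pointSeminorm ξ x ≤ (n + n) * ‖ξ.toSob m‖ := by
    rw [← map_smul_eq_mul, add_mul]
    calc pointSeminorm ξ (t • x) = pointSeminorm ξ ((x₀.1 + t • x) - x₀.1) := by
          rw [add_sub_cancel_left]
      _ ≤ pointSeminorm ξ (x₀.1 + t • x) + pointSeminorm ξ x₀.1 := map_sub_le_add _ _ _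
      _ ≤ _ := add_le_add (h1 ξ) (h2 ξ)
  rwa [mul_assoc, ← div_eq_inv_mul, le_div_iff₀' ht0]

/-- The seminorms `x ↦ max {‖xξ‖, ‖x*ξ‖}`, `|ξ|_m ≤ 1`, whose supremum is `r_m`. -/
def unitBallSeminorm (F : Submodule ℂ LStar) (m : ℕ) (ξ : {ξ : S // ‖ξ.toSob m‖ ≤ 1}) :
    Seminorm ℂ F :=
  (pointSeminorm ξ.1).comp F.subtype

theorem bddAbove_unitBallSeminorm {F : Submodule ℂ LStar} {m : ℕ}
    (h : ∀ x ∈ F, ExtendsTo m x) (x : F) :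
    BddAbove (Set.range fun ξ => unitBallSeminorm F m ξ x) := by
  obtain ⟨C, hC, hx⟩ := (h x.1 x.2).exists_boundedBy
  refine ⟨C, ?_⟩
  rintro _ ⟨ξ, rfl⟩
  exact (boundedBy_iff.1 hx ξ.1).trans (mul_le_of_le_one_right hC ξ.2)

/-- `r_m` as a seminorm on a space of operators on which it is finite. -/
def rSeminorm {F : Submodule ℂ LStar} {m : ℕ} (h : ∀ x ∈ F, ExtendsTo m x) : Seminorm ℂ F :=
  supSeminorm (unitBallSeminorm F m) (bddAbove_unitBallSeminorm h)

theorem rSeminorm_apply {F : Submodule ℂ LStar} {m : ℕ} (h : ∀ x ∈ F, ExtendsTo m x) (x : F) :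
    rSeminorm h x = ⨆ ξ, unitBallSeminorm F m ξ x := rfl

/-- Boundedness of the family lets `ENNReal.ofReal` pass through the real supremum; a supremum of
maxima is the maximum of the suprema. -/
theorem ofReal_rSeminorm {F : Submodule ℂ LStar} {m : ℕ} (h : ∀ x ∈ F, ExtendsTo m x) (x : F) :
    ENNReal.ofReal (rSeminorm h x) = rNorm m x := by
  have : Nonempty {ξ : S // ‖ξ.toSob m‖ ≤ 1} := ⟨⟨0, by simp⟩⟩
  have hs : ENNReal.ofReal (rSeminorm h x) =
      ⨆ ξ, ENNReal.ofReal (unitBallSeminorm F m ξ x) := by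
    rw [rSeminorm_apply]
    exact Monotone.map_ciSup_of_continuousAt ENNReal.continuous_ofReal.continuousAt
      (fun _ _ => ENNReal.ofReal_le_ofReal) (bddAbove_unitBallSeminorm h x)
  rw [hs, rNorm, iSup_subtype', iSup_subtype', ← iSup_sup_eq]
  refine iSup_congr fun ξ => ?_
  change ENNReal.ofReal (max ‖(x.1.1 ξ.1).toEll2‖ ‖((adj x.1).1 ξ.1).toEll2‖) = _
  rw [ENNReal.ofReal_max, ofReal_norm, ofReal_norm]

theorem boundedBy_rSeminorm {F : Submodule ℂ LStar} {m : ℕ} (h : ∀ x ∈ F, ExtendsTo m x) (x : F) :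
    BoundedBy m (rSeminorm h x) x := by
  refine boundedBy_iff.2 fun ξ => ?_
  have hle (η : {ξ : S // ‖ξ.toSob m‖ ≤ 1}) : pointSeminorm η.1 x.1 ≤ rSeminorm h x :=
    le_ciSup (bddAbove_unitBallSeminorm h x) η
  rcases (norm_nonneg (ξ.toSob m)).eq_or_lt with h0 | h0
  · obtain ⟨C, -, hC⟩ := (h x.1 x.2).exists_boundedBy
    simpa only [← h0, mul_zero] using boundedBy_iff.1 hC ξ
  · have hc : ‖((‖ξ.toSob m‖⁻¹ : ℝ) : ℂ)‖ = ‖ξ.toSob m‖⁻¹ := by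
      rw [Complex.norm_real, norm_inv, norm_norm]
    have h1 := hle ⟨((‖ξ.toSob m‖⁻¹ : ℝ) : ℂ) • ξ, by
      rw [map_smul, norm_smul, hc, inv_mul_cancel₀ h0.ne']⟩
    rw [pointSeminorm_apply] at h1 ⊢
    simp only [map_smul, norm_smul, hc] at h1
    rwa [← mul_max_of_nonneg _ _ (inv_nonneg.2 h0.le), ← div_eq_inv_mul, div_le_iff₀ h0] at h1

theorem withSeminorms_restrict (F : Submodule ℂ LStar) :
    WithSeminorms (fun i => (tauStarSeminorms i).comp F.subtype :
      SeminormFamily ℂ F (LStar × {B : Set S // GraphBounded B})) :=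
  withSeminorms_tauStar.comp_subtype F

theorem isDominatingNorm_rSeminorm {F : Submodule ℂ LStar} (hF : IsFrechetSpace F) {m : ℕ}
    (h : ∀ x ∈ F, ExtendsTo m x) : IsDominatingNorm (rSeminorm h) := by
  have := hF.baireSpace
  have := hF.continuousSMul
  have := hF.metrizable
  have hw := withSeminorms_restrict F
  refine ⟨?_, fun x hx => ?_, exists_isFundamentalSystem hw, fun p hp q => ?_⟩
  -- On a barrelled space a pointwise bounded family of continuous seminorms has a continuous
  -- supremum.
  · have hb : BddAbove (Set.range (unitBallSeminorm F m)) :=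
      Seminorm.bddAbove_range_iff.2 (bddAbove_unitBallSeminorm h)
    have hc := Seminorm.continuous_iSup (unitBallSeminorm F m)
      (fun ξ => (continuous_pointSeminorm ξ.1).comp continuous_subtype_val) hb
    convert hc using 1
    funext x
    rw [iSup_apply]
    rfl
  · refine Subtype.ext (Subtype.ext (LinearMap.ext fun ξ => S.toEll2_injective ?_))
    have h1 := (boundedBy_rSeminorm h x ξ).1
    rw [hx, zero_mul, norm_le_zero_iff] at h1
    exact h1.trans (map_zero _).symm
  -- Interpolation holds for the generating seminorms `p^{a,B}`, passes to every continuous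
  -- seminorm, and its right-hand factor `g` is then absorbed by some `p r`.
  · obtain ⟨g, hg, hgq⟩ := exists_sq_le_of_continuous hw (ν := rSeminorm h) (fun i => by
      obtain ⟨a, B⟩ := i
      obtain ⟨D, hD, hDx⟩ := tauStarSeminorms_sq_le a B m
      refine ⟨D.toNNReal • (tauStarSeminorms (adj a * a, B)).comp F.subtype,
        ((hw.continuous_seminorm (adj a * a, B)).const_smul _), fun x => ?_⟩
      refine (hDx x.1 _ (apply_nonneg _ _) (boundedBy_rSeminorm h x)).trans (le_of_eq ?_)
      rw [smul_apply, NNReal.smul_def, Real.coe_toNNReal _ hD, smul_eq_mul,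
        Seminorm.comp_apply, Submodule.subtype_apply]
      ring) (hp.1 q)
    obtain ⟨r, C, hC, hr⟩ := hp.exists_le hg
    refine ⟨r, C, hC, fun x => (hgq x).trans ?_⟩
    rw [mul_comm C, mul_assoc]
    exact mul_le_mul_of_nonneg_left (hr x) (apply_nonneg _ _)

end LStar

end RapidOp

end

theorem mainTheorem8 (F : Submodule ℂ RapidOp.LStar) (hF : RapidOp.IsFrechetSpace F) :
    (∃ m : ℕ, ∀ x ∈ F, RapidOp.LStar.ExtendsTo m x) ∧
    ∀ m : ℕ, (∀ x ∈ F, RapidOp.LStar.ExtendsTo m x) →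
      ∃ ν : Seminorm ℂ F,
        (∀ x : F, ENNReal.ofReal (ν x) = RapidOp.LStar.rNorm m x) ∧
        RapidOp.IsDominatingNorm ν :=
  ⟨RapidOp.LStar.exists_forall_extendsTo F hF, fun _ h =>
    ⟨RapidOp.LStar.rSeminorm h, RapidOp.LStar.ofReal_rSeminorm h,
      RapidOp.LStar.isDominatingNorm_rSeminorm hF h⟩⟩
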